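/- **Setting.** Let $(\mathcal M,g)$ be a closed riemannian spin manifold of dimension $4$, with a fixed orientation and spin structure, volume measure $\nu_g$ and Levi-Civita connection $\widetilde\nabla$. Let $\sigma_1,\sigma_2,\sigma_3$ be the Pauli matrices, $\sigma^0=\tilde\sigma^0=\mathbb I_2$, $\sigma^j=-i\sigma_j$, $\tilde\sigma^j=i\sigma_j$ $(j=1,2,3)$, and $$\gamma^a=\begin{pmatrix}0&\sigma^a\\ \tilde\sigma^a&0\end{pmatrix}\ (a=0,1,2,3),\qquad \gamma=\gamma^1\gamma^2\gamma^3\gamma^0=\mathrm{diag}(\mathbb I_2,-\mathbb I_2),\qquad \mathcal J=i\gamma^0\gamma^2\circ cc,$$ with $cc$ the complex conjugation. Let $U\subseteq\mathcal M$ be the (open) domain of a smooth spin frame over an orthonormal frame $(E_0,E_1,E_2,E_3)$ of the tangent bundle; $U=\mathcal M$ if the frame is global. In this frame spinor fields over $U$ are $\mathbb C^4$-valued functions. Write $\partial_a$ for the derivative along $E_a$, $\widetilde\nabla_{E_c}E_a=\Gamma^b_{ca}E_b$, and $$\gamma^\mu\omega_\mu=\sum_c\gamma^c\,\omega_c,\qquad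 \omega_c=\tfrac14\sum_{a,b}\Gamma^b_{ca}\,\gamma_b\gamma^a\quad(\gamma_b=\gamma^b),$$ so that $\slashed\partial=-i\sum_c\gamma^c(\partial_c+\omega_c)$ is the Dirac operator. For a smooth real $1$-form $\omega_f$ on $\mathcal M$ with components $f_a=\omega_f(E_a)$, the twisted covariant Dirac operator of the minimal twist of $\mathcal M$ is $\slashed\partial_{\omega_f}=\slashed\partial-i\sum_a f_a\gamma^a\gamma$. **Fermionic action.** Let $R=\gamma^a$ be one of the four Dirac matrices of the frame and $\alpha\in\{1,-1\}$. Let $\tilde\psi=\sum_k\theta_k\psi_k$ be a Grassmann vector in the $\alpha$-eigenspace of $R$: a finite sum with $\theta_k$ the generators of a complex Grassmann algebra and $\psi_k$ smooth spinor fields on $\mathcal M$ with support in $U$ such that $R\psi_k=\alpha\psi_k$. For a bilinear form $B$ put $B(\tilde\psi,\tilde\psi)=\sum_{k,l}B(\psi_k,\psi_l)\,\theta_k\theta_l$. The twisted fermionic action is $$S_R(\slashed\partial_{\omega_f})=\mathfrak A(\tilde\psi,\tilde\psi),\qquad \mathfrak A(\phi,\psi)=\langle\mathcal J\phi,\,R\,\slashed\partial_{\omega_f}\psi\rangle,$$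 with $\langle\chi,\psi\rangle=\int_{\mathcal M}\chi^\dagger\psi\,d\nu_g$. Let $\tilde\zeta$ be the first Weyl component of $\tilde\psi$, that is $\tilde\psi=(\tilde\zeta,\alpha^{-1}\tilde\sigma^a\tilde\zeta)$. **Proposition.** With these notations, $$S_R(\slashed\partial_{\omega_f})=i\alpha\,\langle\mathcal J\tilde\psi,\gamma^\mu\omega_\mu\tilde\psi\rangle+2\int_{\mathcal M}{}^T\tilde\zeta\,\sigma_2\Big(if_0-\sum_{j=1}^3\sigma_j\partial_j\Big)\tilde\zeta\,d\nu_g\qquad\text{for }R=\gamma^0,$$ $$S_R(\slashed\partial_{\omega_f})=i\alpha\,\langle\mathcal J\tilde\psi,\gamma^\mu\omega_\mu\tilde\psi\rangle+2\int_{\mathcal M}{}^T\tilde\zeta\,\sigma_2\sigma_a\Big(\partial_0+i\sum_{j\in\{1,2,3\},\,j\neq a}\sigma_j\partial_j+i\sigma_af_a\Big)\tilde\zeta\,d\nu_g\qquad\text{for }R=\gamma^a,\ a\in\{1,2,3\}.$$ -/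

import Mathlib

open scoped Manifold ContDiff Matrix
open MeasureTheory Bundle

noncomputable section

namespace TwistedSpin

/-- The model space of a four-dimensional manifold. -/
abbrev E4 : Type := EuclideanSpace ℝ (Fin 4)

/-- The fibre `ℂ⁴ = ℂ² ⊕ ℂ²` of the spinor bundle in the chiral representation. -/
abbrev DiracVec : Type := Fin 2 ⊕ Fin 2 → ℂ

/-- The fibre `ℂ²` of Weyl spinors. -/
abbrev WeylVec : Type := Fin 2 → ℂ

/-! ### Pauli and Dirac matrices -/

/-- The Pauli matrices `σ₁, σ₂, σ₃`; the index `j : Fin 3` stands for `j + 1`. -/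
def pauli : Fin 3 → Matrix (Fin 2) (Fin 2) ℂ :=
  ![!![0, 1; 1, 0], !![0, -Complex.I; Complex.I, 0], !![1, 0; 0, -1]]

/-- `σ⁰ = 1` and `σʲ = -i σ_j`. -/
def sigmaUp : Fin 4 → Matrix (Fin 2) (Fin 2) ℂ :=
  Fin.cons 1 fun j => (-Complex.I) • pauli j

/-- `σ̃ᵃ = (σᵃ)†`. -/
def sigmaTilde (a : Fin 4) : Matrix (Fin 2) (Fin 2) ℂ := (sigmaUp a)ᴴ

/-- The euclidean Dirac matrices `γ⁰, γ¹, γ², γ³` in the chiral representation. -/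
def gammaMat (a : Fin 4) : Matrix (Fin 2 ⊕ Fin 2) (Fin 2 ⊕ Fin 2) ℂ :=
  Matrix.fromBlocks 0 (sigmaUp a) (sigmaTilde a) 0

/-- The grading `γ = γ¹γ²γ³γ⁰`. -/
def grading : Matrix (Fin 2 ⊕ Fin 2) (Fin 2 ⊕ Fin 2) ℂ :=
  gammaMat 1 * gammaMat 2 * gammaMat 3 * gammaMat 0

/-- The group `Spin(4) = SU(2) × SU(2)` in the chiral spin representation. -/
def spinFour : Set (Matrix (Fin 2 ⊕ Fin 2) (Fin 2 ⊕ Fin 2) ℂ) :=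
  {s | ∃ A ∈ Matrix.specialUnitaryGroup (Fin 2) ℂ, ∃ B ∈ Matrix.specialUnitaryGroup (Fin 2) ℂ,
    s = Matrix.fromBlocks A 0 0 B}

/-- The real structure `𝒥 = i γ⁰γ² ∘ cc`, with `cc` the complex conjugation. -/
def realStructure (v : DiracVec) : DiracVec :=
  Complex.I • ((gammaMat 0 * gammaMat 2) *ᵥ star v)

/-- The first (upper) Weyl component of a field of Dirac spinors. -/
def weylPart {X : Type*} (F : X → DiracVec) (x : X) : WeylVec := fun k => F x (Sum.inl k)

section Geometry

variable {M : Type*} [TopologicalSpace M] [ChartedSpace E4 M] [IsManifold 𝓘(ℝ, E4) ∞ M]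

variable (M) in
/-- Smooth riemannian metrics on the four-dimensional manifold `M`. -/
abbrev Metric : Type _ :=
  ContMDiffRiemannianMetric 𝓘(ℝ, E4) ∞ E4 (fun x : M => TangentSpace 𝓘(ℝ, E4) x)

/-- The smooth real `1`-forms `f_μ dx^μ` on `M`. -/
def IsSmoothOneForm (f : ∀ x : M, TangentSpace 𝓘(ℝ, E4) x →L[ℝ] ℝ) : Prop :=
  ContMDiff 𝓘(ℝ, E4) (𝓘(ℝ, E4).prod 𝓘(ℝ, E4 →L[ℝ] ℝ)) ∞
    (fun x : M => TotalSpace.mk' (E4 →L[ℝ] ℝ)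
      (E := fun x : M => TangentSpace 𝓘(ℝ, E4) x →L[ℝ] ℝ) x (f x))

/-! ### The riemannian volume -/

/-- `√(det g_{μν})` in the chart at `c`, where `g_{μν} = g(∂_μ, ∂_ν)` and the coordinate vectors
`∂_μ` are the images of the standard basis under the differential of the inverse chart. -/
def sqrtDet (g : Metric M) (c : M) (y : E4) : ℝ :=
  Real.sqrt (Matrix.det (Matrix.of fun μ ν : Fin 4 =>
    g.inner ((chartAt E4 c).symm y)
      (mfderiv 𝓘(ℝ, E4) 𝓘(ℝ, E4) (chartAt E4 c).symm y (EuclideanSpace.single μ (1 : ℝ)))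
      (mfderiv 𝓘(ℝ, E4) 𝓘(ℝ, E4) (chartAt E4 c).symm y (EuclideanSpace.single ν (1 : ℝ)))))

/-- A partition of unity subordinate to the charts. -/
def chartPartition (M : Type*) [TopologicalSpace M] [ChartedSpace E4 M]
    [IsManifold 𝓘(ℝ, E4) ∞ M] [CompactSpace M] [T2Space M] :
    SmoothPartitionOfUnity M 𝓘(ℝ, E4) M Set.univ :=
  Classical.choose (SmoothPartitionOfUnity.exists_isSubordinate_chartAt_source 𝓘(ℝ, E4) M)

/-- The riemannian volume measure `ν_g`: with a partition of unity `ρ_c` subordinate to the charts,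
`∫ h dν_g = ∑_c ∫ (ρ_c h) √(det g_{μν}) dx` in the charts. -/
def volumeMeasure [CompactSpace M] [T2Space M] [MeasurableSpace M] (g : Metric M) : Measure M :=
  Measure.sum fun c : M =>
    (((volume : Measure E4).restrict (chartAt E4 c).target).withDensity fun y =>
      ENNReal.ofReal (chartPartition M c ((chartAt E4 c).symm y) * sqrtDet g c y)).map
        (chartAt E4 c).symm

/-! ### The Levi-Civita connection -/

/-- The derivative `(X h)(x)` of a vector-valued function along a tangent vector. -/
def dirDeriv {V : Type*} [NormedAddCommGroup V] [NormedSpace ℝ V] (h : M → V) (x : M)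
    (v : TangentSpace 𝓘(ℝ, E4) x) : V :=
  mfderiv 𝓘(ℝ, E4) 𝓘(ℝ, V) h x v

/-- `g(∇_X Y, Z)` at `x`, with `∇` the Levi-Civita connection of `g`, by the Koszul formula. -/
def leviCivita (g : Metric M) (X Y Z : ∀ x : M, TangentSpace 𝓘(ℝ, E4) x) (x : M) : ℝ :=
  (1 / 2) * (dirDeriv (fun y => g.inner y (Y y) (Z y)) x (X x)
    + dirDeriv (fun y => g.inner y (X y) (Z y)) x (Y x)
    - dirDeriv (fun y => g.inner y (X y) (Y y)) x (Z x)
    + g.inner x (VectorField.mlieBracket 𝓘(ℝ, E4) X Y x) (Z x)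
    - g.inner x (VectorField.mlieBracket 𝓘(ℝ, E4) X Z x) (Y x)
    - g.inner x (VectorField.mlieBracket 𝓘(ℝ, E4) Y Z x) (X x))

/-! ### Spin structures and spinor fields -/

/-- A spin structure on the riemannian manifold `(M, g)`, given by local spin frames: an open cover
by domains `U_i`, on each a smooth orthonormal frame `E_0, …, E_3` of the tangent bundle, and a
smooth cocycle with values in `Spin(4)` that lifts the changes of orthonormal frames. All frame
changes lie in `SO(4)`, so an orientation is part of the data. -/
structure SpinStructure (g : Metric M) (ι : Type*) where
  dom : ι → Set M
  isOpen_dom : ∀ i, IsOpen (dom i)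
  iUnion_dom : ⋃ i, dom i = Set.univ
  frame : ι → Fin 4 → ∀ x : M, TangentSpace 𝓘(ℝ, E4) x
  smooth_frame : ∀ i a, ContMDiffOn 𝓘(ℝ, E4) 𝓘(ℝ, E4).tangent ∞
    (fun x => (⟨x, frame i a x⟩ : TangentBundle 𝓘(ℝ, E4) M)) (dom i)
  orthonormal : ∀ i a b, ∀ x ∈ dom i,
    g.inner x (frame i a x) (frame i b x) = if a = b then 1 else 0
  trans : ι → ι → M → Matrix (Fin 2 ⊕ Fin 2) (Fin 2 ⊕ Fin 2) ℂ
  smooth_trans : ∀ i j k l, ContMDiffOn 𝓘(ℝ, E4) 𝓘(ℝ, ℂ) ∞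
    (fun x => trans i j x k l) (dom i ∩ dom j)
  trans_mem : ∀ i j, ∀ x ∈ dom i ∩ dom j, trans i j x ∈ spinFour
  cocycle : ∀ i j k, ∀ x ∈ dom i ∩ dom j ∩ dom k, trans i j x * trans j k x = trans i k x
  lift : ∀ i j b, ∀ x ∈ dom i ∩ dom j, trans i j x * gammaMat b =
    (∑ a, ((g.inner x (frame i a x) (frame j b x) : ℝ) : ℂ) • gammaMat a) * trans i j x

/-- A smooth section of the spinor bundle, given by its local representatives `ψ_i : U_i → ℂ⁴`
(the values outside `U_i` are irrelevant). -/
structure SpinorField {g : Metric M} {ι : Type*} (S : SpinStructure g ι) where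
  rep : ι → M → DiracVec
  smooth_rep : ∀ i, ContMDiffOn 𝓘(ℝ, E4) 𝓘(ℝ, DiracVec) ∞ (rep i) (S.dom i)
  compat : ∀ i j, ∀ x ∈ S.dom i ∩ S.dom j, rep i x = S.trans i j x *ᵥ rep j x

variable {g : Metric M} {ι : Type*} (S : SpinStructure g ι)

/-- The support of a spinor field. -/
def SpinorField.support {S : SpinStructure g ι} (ψ : SpinorField S) : Set M :=
  closure {x | ∃ i, x ∈ S.dom i ∧ ψ.rep i x ≠ 0}

/-- `∂_a h`: the derivative of `h` along the vector `E_a` of the `i`-th frame. -/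
def frameDeriv (i : ι) (a : Fin 4) {V : Type*} [NormedAddCommGroup V] [NormedSpace ℝ V]
    (h : M → V) (x : M) : V :=
  dirDeriv h x (S.frame i a x)

/-- The matrix `ω_c = ¼ Γ^b_{ca} γ_b γ^a` of the spin connection in the `i`-th frame, where
`∇_{E_c} E_a = Γ^b_{ca} E_b` for the Levi-Civita connection `∇`. -/
def spinConnection (i : ι) (c : Fin 4) (x : M) : Matrix (Fin 2 ⊕ Fin 2) (Fin 2 ⊕ Fin 2) ℂ :=
  (1 / 4 : ℂ) • ∑ a, ∑ b,
    ((leviCivita g (S.frame i c) (S.frame i a) (S.frame i b) x : ℝ) : ℂ) •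
      (gammaMat b * gammaMat a)

/-- `γ^μ ω_μ F`, for the local representative `F` of a spinor field in the `i`-th frame. -/
def connectionTerm (i : ι) (F : M → DiracVec) (x : M) : DiracVec :=
  ∑ c, gammaMat c *ᵥ (spinConnection S i c x *ᵥ F x)

/-- The Dirac operator `∂̸ = -i γ^μ (∂_μ + ω_μ)` on local representatives in the `i`-th frame. -/
def diracOp (i : ι) (F : M → DiracVec) (x : M) : DiracVec :=
  -(Complex.I • ∑ c, gammaMat c *ᵥ (frameDeriv S i c F x + spinConnection S i c x *ᵥ F x))

/-- The component `f_a = f(E_a)` in the `i`-th frame. -/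
def formComp (f : ∀ x : M, TangentSpace 𝓘(ℝ, E4) x →L[ℝ] ℝ) (i : ι) (a : Fin 4) (x : M) : ℂ :=
  ((f x (S.frame i a x) : ℝ) : ℂ)

/-- The twisted covariant Dirac operator `∂̸ - i f_μ γ^μ γ` on local representatives in the `i`-th
frame. -/
def twistedDirac (f : ∀ x : M, TangentSpace 𝓘(ℝ, E4) x →L[ℝ] ℝ) (i : ι) (F : M → DiracVec)
    (x : M) : DiracVec :=
  diracOp S i F x - Complex.I • ∑ a, formComp S f i a x • ((gammaMat a * grading) *ᵥ F x)

/-! ### Forms on spinor fields and the fermionic action -/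

/-- The eigenspace `Rψ = αψ` for `R = γᵃ`, the Dirac matrix taken in the `i`-th frame. As `R` is
defined on the domain of that frame, the support of `ψ` has to lie there; this is no condition when
the frame is globally defined. -/
def eigenspace (i : ι) (a : Fin 4) (α : ℂ) : Set (SpinorField S) :=
  {ψ | ψ.support ⊆ S.dom i ∧ ∀ x ∈ S.dom i, gammaMat a *ᵥ ψ.rep i x = α • ψ.rep i x}

variable [CompactSpace M] [T2Space M] [MeasurableSpace M]

/-- The `L²` product of spinor fields (one of which is supported in the domain of the `i`-th frame),
through the representatives in that frame. -/
def spinorInner (i : ι) (χ ψ : M → DiracVec) : ℂ :=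
  ∫ x in S.dom i, star (χ x) ⬝ᵥ ψ x ∂(volumeMeasure g)

/-- The bilinear form `(𝒥φ, Dψ)_R = ⟨𝒥φ, R D ψ⟩` for `R = γᵃ` and `D = ∂̸ - i f_μ γ^μ γ`. -/
def fermionicForm (f : ∀ x : M, TangentSpace 𝓘(ℝ, E4) x →L[ℝ] ℝ) (i : ι) (a : Fin 4)
    (φ ψ : SpinorField S) : ℂ :=
  spinorInner S i (fun x => realStructure (φ.rep i x))
    (fun x => gammaMat a *ᵥ twistedDirac S f i (ψ.rep i) x)

/-- `⟨𝒥φ, γ^μ ω_μ ψ⟩`. -/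
def connectionForm (i : ι) (φ ψ : SpinorField S) : ℂ :=
  spinorInner S i (fun x => realStructure (φ.rep i x)) (connectionTerm S i (ψ.rep i))

/-- `∫ ᵀφ σ₂ (i f₀ - ∑_{j ≠ 0} σ_j ∂_j) ζ dν_g`. -/
def weylFormZero (f : ∀ x : M, TangentSpace 𝓘(ℝ, E4) x →L[ℝ] ℝ) (i : ι)
    (φ ζ : M → WeylVec) : ℂ :=
  ∫ x in S.dom i, φ x ⬝ᵥ (pauli 1 *ᵥ
    ((Complex.I * formComp S f i 0 x) • ζ x - ∑ j : Fin 3, pauli j *ᵥ frameDeriv S i j.succ ζ x))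
    ∂(volumeMeasure g)

/-- `∫ ᵀφ σ₂ σ_a (∂₀ + i ∑_{j ≠ a} σ_j ∂_j + i σ_a f_a) ζ dν_g`, the sum over spatial `j`. -/
def weylFormSpace (f : ∀ x : M, TangentSpace 𝓘(ℝ, E4) x →L[ℝ] ℝ) (i : ι) (a : Fin 3)
    (φ ζ : M → WeylVec) : ℂ :=
  ∫ x in S.dom i, φ x ⬝ᵥ ((pauli 1 * pauli a) *ᵥ
    (frameDeriv S i 0 ζ x
      + Complex.I • ∑ j ∈ Finset.univ.erase a, pauli j *ᵥ frameDeriv S i j.succ ζ x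
      + (Complex.I * formComp S f i a.succ x) • (pauli a *ᵥ ζ x)))
    ∂(volumeMeasure g)

end Geometry

/-- The value `B(ψ̃, ψ̃)` of a bilinear form on the Grassmann vector `ψ̃ = ∑ θ_k ψ_k`, where
`θ_0, …, θ_{N-1}` are the generators of the complex Grassmann algebra: it is
`∑ B(ψ_k, ψ_l) θ_k θ_l`. -/
def grassmannValue {V : Type*} (B : V → V → ℂ) {N : ℕ} (ψ : Fin N → V) :
    ExteriorAlgebra ℂ (Fin N → ℂ) :=
  ∑ k, ∑ l, B (ψ k) (ψ l) •
    (ExteriorAlgebra.ι ℂ (Pi.single k (1 : ℂ)) * ExteriorAlgebra.ι ℂ (Pi.single l (1 : ℂ)))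

section Action

variable {M : Type*} [TopologicalSpace M] [ChartedSpace E4 M] [IsManifold 𝓘(ℝ, E4) ∞ M]
  [CompactSpace M] [T2Space M] [MeasurableSpace M] {g : Metric M} {ι : Type*}

/-- The twisted fermionic action `S_R(∂̸ - i f_μ γ^μ γ)`, for `R = γᵃ` in the `i`-th frame, at the
Grassmann vector `ψ̃ = ∑ θ_k ψ_k`. -/
def fermionicAction (S : SpinStructure g ι) (f : ∀ x : M, TangentSpace 𝓘(ℝ, E4) x →L[ℝ] ℝ)
    (i : ι) (a : Fin 4) {N : ℕ} (ψ : Fin N → SpinorField S) : ExteriorAlgebra ℂ (Fin N → ℂ) :=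
  grassmannValue (fermionicForm S f i a) ψ

end Action

end TwistedSpin

end

noncomputable section

namespace TwistedSpin

/-! ### Continuity, the riemannian volume and integrability -/

section Geometry

variable {M : Type*} [TopologicalSpace M] [ChartedSpace E4 M]

/-! The identity is pointwise and bilinear: it holds for each pair `ψ k`, `ψ l` before the Grassmann
variables enter, so neither their anticommutation nor integration by parts is used.

Let `R = γᵃ`. It is hermitian with square one, and `𝒥` anticommutes with it, so `𝒥φ` lies in the
`-α`-eigenspace of `R`. Hence `R` inside the product becomes the factor `-α`, which with the `-i` of
the Dirac operator gives `iα`. The connection term is then kept as it stands. As `γᵃ` is constant in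
the frame, the `∂_c ψ` are again `α`-eigenvectors. Eigenspaces of `R` with different eigenvalues are
orthogonal, so only the parts of `γᶜ ∂_c ψ` and `f_c γᶜγ ψ` in the `-α`-eigenspace count: the
derivatives with `c ≠ a` and the single component `f_a`. The two Weyl halves contribute equally,
whence the factor 2. This is `weyl_identity_zero` and `weyl_identity_space`, checked in coordinates.

To integrate, both summands must be integrable separately (`fermionicForm_eq_add`). They are
continuous on the domain of the frame and vanish off a compact subset of it, and the volume is
finite. -/

theorem dirDeriv_eq_zero_of_eqOn {V : Type*} [NormedAddCommGroup V] [NormedSpace ℝ V]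
    {U : Set M} (hU : IsOpen U) {h : M → V} {c : V} (hc : ∀ x ∈ U, h x = c) {x : M} (hx : x ∈ U)
    (v : TangentSpace 𝓘(ℝ, E4) x) : dirDeriv h x v = 0 := by
  have : h =ᶠ[nhds x] fun _ => c := by
    filter_upwards [hU.mem_nhds hx] with y hy using hc y hy
  rw [dirDeriv, this.mfderiv_eq, mfderiv_const]
  rfl

theorem dirDeriv_clm_comp {V W : Type*} [NormedAddCommGroup V] [NormedSpace ℝ V]
    [NormedAddCommGroup W] [NormedSpace ℝ W] (A : V →L[ℝ] W) {h : M → V} {x : M}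
    (hh : MDifferentiableAt 𝓘(ℝ, E4) 𝓘(ℝ, V) h x) (v : TangentSpace 𝓘(ℝ, E4) x) :
    dirDeriv (fun y => A (h y)) x v = A (dirDeriv h x v) := by
  have h1 := mfderiv_comp x (I'' := 𝓘(ℝ, W)) A.mdifferentiableAt hh
  have h2 : mfderiv 𝓘(ℝ, V) 𝓘(ℝ, W) A (h x) = A := by
    rw [mfderiv_eq_fderiv]; exact A.fderiv
  rw [h2] at h1
  exact congrArg (fun B : TangentSpace 𝓘(ℝ, E4) x →L[ℝ] W => B v) h1

variable [IsManifold 𝓘(ℝ, E4) ∞ M]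

theorem continuousOn_mfderiv_apply {N : Type*} [TopologicalSpace N] [ChartedSpace E4 N]
    [IsManifold 𝓘(ℝ, E4) ∞ N] {V : Type*} [NormedAddCommGroup V] [NormedSpace ℝ V]
    {H : Type*} [TopologicalSpace H] {I : ModelWithCorners ℝ V H} {P : Type*}
    [TopologicalSpace P] [ChartedSpace H P] [IsManifold I ∞ P]
    {U : Set N} (hU : IsOpen U) {h : N → P} (hh : ContMDiffOn 𝓘(ℝ, E4) I ∞ h U)
    {X : ∀ x : N, TangentSpace 𝓘(ℝ, E4) x}
    (hX : ContinuousOn (fun x => (⟨x, X x⟩ : TangentBundle 𝓘(ℝ, E4) N)) U) :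
    ContinuousOn (fun x => (⟨h x, mfderiv 𝓘(ℝ, E4) I h x (X x)⟩ : TangentBundle I P)) U := by
  have : IsManifold 𝓘(ℝ, E4) 1 N := IsManifold.of_le (n := ∞) (by norm_cast)
  have : IsManifold I 1 P := IsManifold.of_le (n := ∞) (by norm_cast)
  have hT := hh.continuousOn_tangentMapWithin (by norm_cast) hU.uniqueMDiffOn
  refine (hT.comp hX fun x hx => hx).congr fun x hx => ?_
  simp [tangentMapWithin, mfderivWithin_of_isOpen hU hx]

theorem continuousOn_dirDeriv {V : Type*} [NormedAddCommGroup V] [NormedSpace ℝ V]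
    {U : Set M} (hU : IsOpen U) {h : M → V} (hh : ContMDiffOn 𝓘(ℝ, E4) 𝓘(ℝ, V) ∞ h U)
    {X : ∀ x : M, TangentSpace 𝓘(ℝ, E4) x}
    (hX : ContinuousOn (fun x => (⟨x, X x⟩ : TangentBundle 𝓘(ℝ, E4) M)) U) :
    ContinuousOn (fun x => dirDeriv h x (X x)) U :=
  (contMDiff_snd_tangentBundle_modelSpace (n := 0) V 𝓘(ℝ, V)).continuous.comp_continuousOn
    (continuousOn_mfderiv_apply hU hh hX)

theorem continuousOn_metric (g : Metric M) {N : Type*} [TopologicalSpace N] {s : Set N}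
    {b : N → M} {X Y : ∀ x : N, TangentSpace 𝓘(ℝ, E4) (b x)}
    (hX : ContinuousOn (fun x => (⟨b x, X x⟩ : TangentBundle 𝓘(ℝ, E4) M)) s)
    (hY : ContinuousOn (fun x => (⟨b x, Y x⟩ : TangentBundle 𝓘(ℝ, E4) M)) s) :
    ContinuousOn (fun x => g.inner (b x) (X x) (Y x)) s := by
  have hb : ContinuousOn b s :=
    (FiberBundle.continuous_proj E4 (TangentSpace 𝓘(ℝ, E4))).comp_continuousOn hX
  have hg := g.contMDiff.continuous.comp_continuousOn hb
  have h := ContinuousOn.clm_bundle_apply₂ (F₁ := E4) (F₂ := E4) (F₃ := ℝ)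
    (E₁ := fun x : M => TangentSpace 𝓘(ℝ, E4) x) (E₂ := fun x : M => TangentSpace 𝓘(ℝ, E4) x)
    (E₃ := Bundle.Trivial M ℝ)
    (ψ := fun x => g.inner (b x)) hg hX hY
  intro x hx
  -- `h` gives continuity into the total space of the trivial line bundle; its fibre coordinate is
  -- the function wanted.
  exact (Bundle.Trivial.homeomorphProd M ℝ).continuous.snd.continuousAt.comp_continuousWithinAt
    (h x hx)

theorem continuousOn_oneForm {f : ∀ x : M, TangentSpace 𝓘(ℝ, E4) x →L[ℝ] ℝ}
    (hf : IsSmoothOneForm f) {s : Set M} {X : ∀ x : M, TangentSpace 𝓘(ℝ, E4) x}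
    (hX : ContinuousOn (fun x => (⟨x, X x⟩ : TangentBundle 𝓘(ℝ, E4) M)) s) :
    ContinuousOn (fun x => f x (X x)) s := by
  have h := ContinuousOn.clm_bundle_apply (F₁ := E4) (F₂ := ℝ) (b := fun x : M => x)
    (E₁ := fun x : M => TangentSpace 𝓘(ℝ, E4) x) (E₂ := Bundle.Trivial M ℝ)
    (ϕ := f) hf.continuous.continuousOn hX
  intro x hx
  exact (Bundle.Trivial.homeomorphProd M ℝ).continuous.snd.continuousAt.comp_continuousWithinAt
    (h x hx)

theorem continuousOn_sqrtDet (g : Metric M) (c : M) :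
    ContinuousOn (sqrtDet g c) (chartAt E4 c).target := by
  have hsec (v : E4) : ContinuousOn
      (fun y : E4 => (⟨y, v⟩ : TangentBundle 𝓘(ℝ, E4) E4)) (chartAt E4 c).target :=
    ((tangentBundleModelSpaceHomeomorph 𝓘(ℝ, E4)).symm.continuous.comp
      (continuous_id.prodMk continuous_const)).continuousOn
  have hm (v : E4) := continuousOn_mfderiv_apply (chartAt E4 c).open_target
    (contMDiffOn_chart_symm (I := 𝓘(ℝ, E4)) (n := ∞) (x := c)) (hsec v)
  refine Real.continuous_sqrt.comp_continuousOn ?_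
  have hcont : ContinuousOn (fun y : E4 => Matrix.of fun μ ν : Fin 4 =>
    g.inner ((chartAt E4 c).symm y)
      (mfderiv 𝓘(ℝ, E4) 𝓘(ℝ, E4) (chartAt E4 c).symm y (EuclideanSpace.single μ (1 : ℝ)))
      (mfderiv 𝓘(ℝ, E4) 𝓘(ℝ, E4) (chartAt E4 c).symm y (EuclideanSpace.single ν (1 : ℝ))))
      (chartAt E4 c).target :=
    continuousOn_pi.2 fun μ => continuousOn_pi.2 fun ν =>
      continuousOn_metric g (hm (EuclideanSpace.single μ (1 : ℝ)))
        (hm (EuclideanSpace.single ν (1 : ℝ)))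
  exact (Continuous.matrix_det continuous_id).comp_continuousOn hcont

/-- By compactness only finitely many functions of the partition are nonzero. Each has compact
support inside its chart, where the continuous density is bounded. -/
instance isFiniteMeasure_volumeMeasure [CompactSpace M] [T2Space M] [MeasurableSpace M]
    (g : Metric M) : IsFiniteMeasure (volumeMeasure g) := by
  have hsub : (chartPartition M).IsSubordinate fun c => (chartAt E4 c).source :=
    Classical.choose_spec (SmoothPartitionOfUnity.exists_isSubordinate_chartAt_source 𝓘(ℝ, E4) M)
  have hfin : {c : M | (Function.support (chartPartition M c)).Nonempty}.Finite :=
    (chartPartition M).locallyFinite.finite_nonempty_of_compact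
  have hlt (c : M) : ∫⁻ y in (chartAt E4 c).target,
      ENNReal.ofReal (chartPartition M c ((chartAt E4 c).symm y) * sqrtDet g c y) < ⊤ := by
    set e := chartAt E4 c
    have hK : IsCompact (e '' tsupport (chartPartition M c)) :=
      (isClosed_tsupport _).isCompact.image_of_continuousOn (e.continuousOn.mono (hsub c))
    have hKt : e '' tsupport (chartPartition M c) ⊆ e.target := by
      rintro _ ⟨x, hx, rfl⟩
      exact e.map_source (hsub c hx)
    obtain ⟨C, hC⟩ := hK.exists_bound_of_continuousOn
      (f := fun y => chartPartition M c (e.symm y) * sqrtDet g c y)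
      ((((chartPartition M c).contMDiff.continuous.comp_continuousOn e.continuousOn_symm).mul
        (continuousOn_sqrtDet g c)).mono hKt)
    calc _ ≤ ∫⁻ y in e.target, (e '' tsupport (chartPartition M c)).indicator
          (fun _ => ENNReal.ofReal C) y := by
          refine setLIntegral_mono' e.open_target.measurableSet fun y hy => ?_
          by_cases hyK : y ∈ e '' tsupport (chartPartition M c)
          · rw [Set.indicator_of_mem hyK]
            exact ENNReal.ofReal_le_ofReal ((le_abs_self _).trans (hC y hyK))
          · have : chartPartition M c (e.symm y) = 0 := by
              by_contra hne
              exact hyK ⟨e.symm y, subset_tsupport _ hne, e.right_inv hy⟩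
            simp [this]
      _ ≤ ∫⁻ y, (e '' tsupport (chartPartition M c)).indicator
          (fun _ => ENNReal.ofReal C) y := setLIntegral_le_lintegral _ _
      _ < ⊤ := by
          rw [lintegral_indicator hK.measurableSet, setLIntegral_const]
          exact ENNReal.mul_lt_top ENNReal.ofReal_lt_top hK.measure_lt_top
  have hterm (c : M) := isFiniteMeasure_withDensity (hlt c).ne
  constructor
  rw [volumeMeasure, Measure.sum_apply _ MeasurableSet.univ,
    tsum_eq_sum (s := hfin.toFinset)]
  · exact ENNReal.sum_lt_top.2 fun c _ => measure_lt_top _ _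
  · intro c hc
    have h0 : chartPartition M c = 0 := by
      ext x
      by_contra hne
      exact hc (hfin.mem_toFinset.2 ⟨x, hne⟩)
    simp [h0]

theorem integrableOn_of_continuousOn_of_support [CompactSpace M] [T2Space M] [MeasurableSpace M]
    [BorelSpace M] (g : Metric M) {U K : Set M} (hU : IsOpen U) (hK : IsClosed K) (hKU : K ⊆ U)
    {h : M → ℂ} (hh : ContinuousOn h U) (h0 : ∀ x ∈ U, x ∉ K → h x = 0) :
    IntegrableOn h U (volumeMeasure g) := by
  obtain ⟨C, hC⟩ := hK.isCompact.exists_bound_of_continuousOn (hh.mono hKU)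
  refine IntegrableOn.of_bound (measure_lt_top _ _)
    -- `C` may be negative when `K` is empty, while the bound must also cover the zeros off `K`.
    (hh.aestronglyMeasurable hU.measurableSet) (max C 0) ?_
  refine (ae_restrict_iff' hU.measurableSet).2 (.of_forall fun x hx => ?_)
  by_cases hxK : x ∈ K
  · exact (hC x hxK).trans (le_max_left _ _)
  · simp [h0 x hx hxK]

end Geometry

/-! ### Algebra of the Dirac matrices -/

theorem sigmaUp_succ (j : Fin 3) : sigmaUp j.succ = (-Complex.I) • pauli j := rfl

theorem sigmaUp_eq : sigmaUp = ![1, !![0, -Complex.I; -Complex.I, 0], !![0, -1; 1, 0],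
    !![-Complex.I, 0; 0, Complex.I]] := by
  ext a i j
  refine Fin.cases ?_ (fun a => ?_) a
  · rfl
  · rw [sigmaUp_succ]
    fin_cases a <;> fin_cases i <;> fin_cases j <;> simp [pauli]

theorem sigmaTilde_eq (a : Fin 4) : sigmaTilde a = (![1, !![0, Complex.I; Complex.I, 0],
    !![0, 1; -1, 0], !![Complex.I, 0; 0, -Complex.I]] : Fin 4 → Matrix (Fin 2) (Fin 2) ℂ) a := by
  ext i j
  rw [sigmaTilde, sigmaUp_eq]
  fin_cases a <;> fin_cases i <;> fin_cases j <;> simp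

/-- With the action written in components, the later spinor identities become polynomial identities
over `ℂ`. -/
theorem gammaMat_mulVec (a : Fin 4) (u : DiracVec) : gammaMat a *ᵥ u =
    (![Sum.elim ![u (Sum.inr 0), u (Sum.inr 1)] ![u (Sum.inl 0), u (Sum.inl 1)],
      Sum.elim ![-Complex.I * u (Sum.inr 1), -Complex.I * u (Sum.inr 0)]
        ![Complex.I * u (Sum.inl 1), Complex.I * u (Sum.inl 0)],
      Sum.elim ![-u (Sum.inr 1), u (Sum.inr 0)] ![u (Sum.inl 1), -u (Sum.inl 0)],
      Sum.elim ![-Complex.I * u (Sum.inr 0), Complex.I * u (Sum.inr 1)]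
        ![Complex.I * u (Sum.inl 0), -Complex.I * u (Sum.inl 1)]] : Fin 4 → DiracVec) a := by
  rw [gammaMat, sigmaTilde_eq, sigmaUp_eq, Matrix.fromBlocks_mulVec]
  ext (k | k) <;> fin_cases a <;> fin_cases k <;>
    simp [dotProduct, Fin.sum_univ_two]

theorem grading_mulVec (u : DiracVec) : grading *ᵥ u =
    Sum.elim ![u (Sum.inl 0), u (Sum.inl 1)] ![-u (Sum.inr 0), -u (Sum.inr 1)] := by
  simp only [grading, ← Matrix.mulVec_mulVec, gammaMat_mulVec]
  ext (k | k) <;> fin_cases k <;> simp [← mul_assoc]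

theorem pauli_mulVec (j : Fin 3) (u : WeylVec) : pauli j *ᵥ u =
    (![![u 1, u 0], ![-Complex.I * u 1, Complex.I * u 0], ![u 0, -u 1]] : Fin 3 → WeylVec) j := by
  ext k
  fin_cases j <;> fin_cases k <;> simp [pauli, Matrix.mulVec, dotProduct, Fin.sum_univ_two]

theorem star_realStructure (v : DiracVec) : star (realStructure v) =
    Sum.elim ![-Complex.I * v (Sum.inl 1), Complex.I * v (Sum.inl 0)]
      ![Complex.I * v (Sum.inr 1), -Complex.I * v (Sum.inr 0)] := by
  simp only [realStructure, ← Matrix.mulVec_mulVec, gammaMat_mulVec]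
  ext (k | k) <;> fin_cases k <;> simp

/-- Since `α² = 1`. After unfolding, this expresses the lower Weyl component through the upper one.
-/
theorem inr_of_gammaMat_mulVec_eq {a : Fin 4} {α : ℂ} (hα : α = 1 ∨ α = -1) {v : DiracVec}
    (hv : gammaMat a *ᵥ v = α • v) (k : Fin 2) :
    v (Sum.inr k) = α * (gammaMat a *ᵥ v) (Sum.inr k) := by
  rw [hv]
  rcases hα with rfl | rfl <;> simp

/-- `γᵃ` is hermitian and anticommutes with `𝒥`, so `γᵃ𝒥v = -α𝒥v`. The proof verifies this in
components. -/
theorem star_realStructure_dotProduct_gammaMat_mulVec {a : Fin 4} {α : ℂ}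
    (hα : α = 1 ∨ α = -1) {v : DiracVec} (hv : gammaMat a *ᵥ v = α • v) (z : DiracVec) :
    star (realStructure v) ⬝ᵥ (gammaMat a *ᵥ z) = -α * (star (realStructure v) ⬝ᵥ z) := by
  have h0 := inr_of_gammaMat_mulVec_eq hα hv 0
  have h1 := inr_of_gammaMat_mulVec_eq hα hv 1
  simp only [gammaMat_mulVec, star_realStructure] at h0 h1 ⊢
  fin_cases a <;> simp [dotProduct, Fin.sum_univ_two] at h0 h1 ⊢ <;> rw [h0, h1] <;>
    rcases hα with rfl | rfl <;> ring_nf <;> simp [Complex.I_sq] <;> ring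

/-- Here `d c` stands for `∂_c ψ` and `p c` for `f_c`. Eliminating all lower components leaves an
identity in the upper ones. -/
theorem weyl_identity_zero {α : ℂ} (hα : α = 1 ∨ α = -1) {v w : DiracVec} {d : Fin 4 → DiracVec}
    (hv : gammaMat 0 *ᵥ v = α • v) (hw : gammaMat 0 *ᵥ w = α • w)
    (hd : ∀ c, gammaMat 0 *ᵥ d c = α • d c) (p : Fin 4 → ℂ) :
    Complex.I * α * (star (realStructure v) ⬝ᵥ
        (∑ c, gammaMat c *ᵥ d c + ∑ c, p c • ((gammaMat c * grading) *ᵥ w)))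
      = 2 * ((fun k => v (Sum.inl k)) ⬝ᵥ (pauli 1 *ᵥ
        ((Complex.I * p 0) • (fun k => w (Sum.inl k))
          - ∑ j : Fin 3, pauli j *ᵥ fun k => d j.succ (Sum.inl k)))) := by
  have v0 := inr_of_gammaMat_mulVec_eq hα hv 0
  have v1 := inr_of_gammaMat_mulVec_eq hα hv 1
  have w0 := inr_of_gammaMat_mulVec_eq hα hw 0
  have w1 := inr_of_gammaMat_mulVec_eq hα hw 1
  have d0 := fun c => inr_of_gammaMat_mulVec_eq hα (hd c) 0
  have d1 := fun c => inr_of_gammaMat_mulVec_eq hα (hd c) 1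
  simp only [← Matrix.mulVec_mulVec, Fin.sum_univ_three, Fin.sum_univ_four, gammaMat_mulVec,
    grading_mulVec, star_realStructure, pauli_mulVec] at v0 v1 w0 w1 d0 d1 ⊢
  simp [dotProduct, Fin.sum_univ_two] at v0 v1 w0 w1 d0 d1 ⊢
  simp only [v0, v1, w0, w1, d0, d1]
  generalize d 0 = d0, d 1 = d1, d 2 = d2, d 3 = d3
  rcases hα with rfl | rfl <;> ring_nf <;> simp only [Complex.I_sq, Complex.I_pow_three] <;> ring

theorem weyl_identity_space (a : Fin 3) {α : ℂ} (hα : α = 1 ∨ α = -1) {v w : DiracVec}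
    {d : Fin 4 → DiracVec} (hv : gammaMat a.succ *ᵥ v = α • v) (hw : gammaMat a.succ *ᵥ w = α • w)
    (hd : ∀ c, gammaMat a.succ *ᵥ d c = α • d c) (p : Fin 4 → ℂ) :
    Complex.I * α * (star (realStructure v) ⬝ᵥ
        (∑ c, gammaMat c *ᵥ d c + ∑ c, p c • ((gammaMat c * grading) *ᵥ w)))
      = 2 * ((fun k => v (Sum.inl k)) ⬝ᵥ ((pauli 1 * pauli a) *ᵥ
        ((fun k => d 0 (Sum.inl k))
          + Complex.I • ∑ j ∈ Finset.univ.erase a, pauli j *ᵥ (fun k => d j.succ (Sum.inl k))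
          + (Complex.I * p a.succ) • (pauli a *ᵥ fun k => w (Sum.inl k))))) := by
  have v0 := inr_of_gammaMat_mulVec_eq hα hv 0
  have v1 := inr_of_gammaMat_mulVec_eq hα hv 1
  have w0 := inr_of_gammaMat_mulVec_eq hα hw 0
  have w1 := inr_of_gammaMat_mulVec_eq hα hw 1
  have d0 := fun c => inr_of_gammaMat_mulVec_eq hα (hd c) 0
  have d1 := fun c => inr_of_gammaMat_mulVec_eq hα (hd c) 1
  -- Turns the sum over `j ≠ a` into a full sum, which expands uniformly in `a`.
  have e (F : Fin 3 → WeylVec) : ∑ j ∈ Finset.univ.erase a, F j = ∑ j, F j - F a :=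
    eq_sub_of_add_eq (Finset.sum_erase_add _ _ (Finset.mem_univ a))
  rw [e]
  clear e hv hw hd
  simp only [← Matrix.mulVec_mulVec, Fin.sum_univ_three, Fin.sum_univ_four, gammaMat_mulVec,
    grading_mulVec, star_realStructure, pauli_mulVec] at v0 v1 w0 w1 d0 d1 ⊢
  fin_cases a <;> simp [dotProduct, Fin.sum_univ_two] at v0 v1 w0 w1 d0 d1 ⊢ <;>
    simp only [v0, v1, w0, w1, d0, d1] <;>
    generalize d 0 = d0, d 1 = d1, d 2 = d2, d 3 = d3 <;>
    rcases hα with rfl | rfl <;> ring_nf <;>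
    simp only [Complex.I_sq, Complex.I_pow_three, Complex.I_pow_four, Matrix.vecHead,
      Matrix.vecTail, Function.comp, Fin.succ_zero_eq_one] <;> ring

/-! ### The fermionic action -/

theorem grassmannValue_eq_add {V W : Type*} {B B₁ : V → V → ℂ} {B₂ : W → W → ℂ} {s t : ℂ} {N : ℕ}
    {ψ : Fin N → V} {ζ : Fin N → W}
    (h : ∀ k l, B (ψ k) (ψ l) = s * B₁ (ψ k) (ψ l) + t * B₂ (ζ k) (ζ l)) :
    grassmannValue B ψ = s • grassmannValue B₁ ψ + t • grassmannValue B₂ ζ := by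
  simp only [grassmannValue, Finset.smul_sum, ← Finset.sum_add_distrib, h, add_smul, mul_smul]

theorem continuousOn_mulVec {X m n : Type*} [TopologicalSpace X] [Fintype n] {s : Set X}
    {A : X → Matrix m n ℂ} {v : X → n → ℂ} (hA : ContinuousOn A s) (hv : ContinuousOn v s) :
    ContinuousOn (fun x => A x *ᵥ v x) s :=
  (Continuous.matrix_mulVec continuous_fst continuous_snd).comp_continuousOn (hA.prodMk hv)

theorem continuousOn_dotProduct {X n : Type*} [TopologicalSpace X] [Fintype n] {s : Set X}
    {u v : X → n → ℂ} (hu : ContinuousOn u s) (hv : ContinuousOn v s) :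
    ContinuousOn (fun x => u x ⬝ᵥ v x) s :=
  (Continuous.dotProduct continuous_fst continuous_snd).comp_continuousOn (hu.prodMk hv)

theorem continuous_realStructure : Continuous realStructure := by
  have h : Continuous fun v : DiracVec => (gammaMat 0 * gammaMat 2) *ᵥ star v :=
    continuous_const.matrix_mulVec continuous_star
  exact h.const_smul Complex.I

/-! ### Spinor fields in a frame: derivatives and continuity -/

section Geometry

variable {M : Type*} [TopologicalSpace M] [ChartedSpace E4 M] [IsManifold 𝓘(ℝ, E4) ∞ M]
  {g : Metric M} {ι : Type*} {S : SpinStructure g ι}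

theorem frameDeriv_weylPart {i : ι} (c : Fin 4) {F : M → DiracVec}
    (hF : ContMDiffOn 𝓘(ℝ, E4) 𝓘(ℝ, DiracVec) ∞ F (S.dom i)) {x : M} (hx : x ∈ S.dom i) :
    frameDeriv S i c (weylPart F) x = fun k => frameDeriv S i c F x (Sum.inl k) :=
  dirDeriv_clm_comp (ContinuousLinearMap.pi fun k : Fin 2 =>
      ContinuousLinearMap.proj (R := ℝ) (φ := fun _ : Fin 2 ⊕ Fin 2 => ℂ) (Sum.inl k))
    ((hF.contMDiffAt ((S.isOpen_dom i).mem_nhds hx)).mdifferentiableAt (by simp)) _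

/-- The constant linear map `γᵃ - α` annihilates `F` on an open set, hence also its derivatives
there. -/
theorem gammaMat_mulVec_frameDeriv {i : ι} (a c : Fin 4) {α : ℂ} {F : M → DiracVec}
    (hF : ContMDiffOn 𝓘(ℝ, E4) 𝓘(ℝ, DiracVec) ∞ F (S.dom i))
    (h : ∀ x ∈ S.dom i, gammaMat a *ᵥ F x = α • F x) {x : M} (hx : x ∈ S.dom i) :
    gammaMat a *ᵥ frameDeriv S i c F x = α • frameDeriv S i c F x := by
  let A : DiracVec →L[ℝ] DiracVec :=
    (LinearMap.toContinuousLinearMap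
      (Matrix.mulVecLin (gammaMat a) - α • LinearMap.id)).restrictScalars ℝ
  have hA (v : DiracVec) : A v = gammaMat a *ᵥ v - α • v := rfl
  have h0 := dirDeriv_eq_zero_of_eqOn (S.isOpen_dom i) (h := fun y => A (F y)) (c := 0)
    (fun y hy => by rw [hA, h y hy, sub_self]) hx (S.frame i c x)
  rw [dirDeriv_clm_comp A
    ((hF.contMDiffAt ((S.isOpen_dom i).mem_nhds hx)).mdifferentiableAt (by simp)), hA] at h0
  exact sub_eq_zero.1 h0

variable (S) in
theorem continuousOn_frame (i : ι) (a : Fin 4) :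
    ContinuousOn (fun x => (⟨x, S.frame i a x⟩ : TangentBundle 𝓘(ℝ, E4) M)) (S.dom i) :=
  (S.smooth_frame i a).continuousOn

theorem continuousOn_frameDeriv {i : ι} (c : Fin 4) {V : Type*} [NormedAddCommGroup V]
    [NormedSpace ℝ V] {h : M → V} (hh : ContMDiffOn 𝓘(ℝ, E4) 𝓘(ℝ, V) ∞ h (S.dom i)) :
    ContinuousOn (frameDeriv S i c h) (S.dom i) :=
  continuousOn_dirDeriv (S.isOpen_dom i) hh (continuousOn_frame S i c)

theorem continuousOn_frameDeriv_weylPart {i : ι} (c : Fin 4) {F : M → DiracVec}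
    (hF : ContMDiffOn 𝓘(ℝ, E4) 𝓘(ℝ, DiracVec) ∞ F (S.dom i)) :
    ContinuousOn (frameDeriv S i c (weylPart F)) (S.dom i) :=
  (continuousOn_pi.2 fun k => continuousOn_pi.1 (continuousOn_frameDeriv c hF) (Sum.inl k)).congr
    fun _ hx => frameDeriv_weylPart c hF hx

variable (S) in
theorem continuousOn_mlieBracket_frame (i : ι) (a b : Fin 4) :
    ContinuousOn (fun x => (⟨x, VectorField.mlieBracket 𝓘(ℝ, E4) (S.frame i a) (S.frame i b) x⟩ :
      TangentBundle 𝓘(ℝ, E4) M)) (S.dom i) := by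
  intro x hx
  have hn := (S.isOpen_dom i).mem_nhds hx
  -- The bracket costs one derivative, so regularity `∞ + 1` is asked for; it is the same as `∞`.
  have : IsManifold 𝓘(ℝ, E4) (((⊤ : ℕ∞) : WithTop ℕ∞) + 1) M := ‹IsManifold 𝓘(ℝ, E4) ∞ M›
  have : IsManifold 𝓘(ℝ, E4) (minSmoothness ℝ 2) M := by
    rw [minSmoothness_of_isRCLikeNormedField]
    exact IsManifold.of_le (n := ∞) (by norm_cast)
  exact (ContMDiffAt.mlieBracket_vectorField (m := 0) (n := ⊤)
    ((S.smooth_frame i a).contMDiffAt hn) ((S.smooth_frame i b).contMDiffAt hn)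
    (by simp)).continuousAt.continuousWithinAt

variable (S) in
-- Inner products of an orthonormal frame are constant, so the derivative terms of the Koszul
-- formula vanish. The bracket terms that remain are visibly continuous.
theorem leviCivita_frame (i : ι) (a b c : Fin 4) {x : M} (hx : x ∈ S.dom i) :
    leviCivita g (S.frame i a) (S.frame i b) (S.frame i c) x = (1 / 2) *
      (g.inner x (VectorField.mlieBracket 𝓘(ℝ, E4) (S.frame i a) (S.frame i b) x) (S.frame i c x)
      - g.inner x (VectorField.mlieBracket 𝓘(ℝ, E4) (S.frame i a) (S.frame i c) x) (S.frame i b x)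
      - g.inner x (VectorField.mlieBracket 𝓘(ℝ, E4) (S.frame i b) (S.frame i c) x)
        (S.frame i a x)) := by
  have h (p q : Fin 4) (v : TangentSpace 𝓘(ℝ, E4) x) :
      dirDeriv (fun y => g.inner y (S.frame i p y) (S.frame i q y)) x v = 0 :=
    dirDeriv_eq_zero_of_eqOn (S.isOpen_dom i) (S.orthonormal i p q) hx v
  rw [leviCivita, h, h, h]
  ring

variable (S) in
theorem continuousOn_spinConnection (i : ι) (c : Fin 4) :
    ContinuousOn (spinConnection S i c) (S.dom i) := by
  have hL (a b : Fin 4) : ContinuousOn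
      (leviCivita g (S.frame i c) (S.frame i a) (S.frame i b)) (S.dom i) := by
    have h (p q r : Fin 4) := continuousOn_metric g (b := fun x => x)
      (continuousOn_mlieBracket_frame S i p q) (continuousOn_frame S i r)
    exact (continuousOn_const.mul (((h c a b).sub (h c b a)).sub (h a b c))).congr
      fun x hx => leviCivita_frame S i c a b hx
  have h : ContinuousOn (fun x => ∑ a, ∑ b,
      ((leviCivita g (S.frame i c) (S.frame i a) (S.frame i b) x : ℝ) : ℂ) •
        (gammaMat b * gammaMat a)) (S.dom i) :=
    continuousOn_finsetSum _ fun a _ => continuousOn_finsetSum _ fun b _ =>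
      (Complex.continuous_ofReal.comp_continuousOn (hL a b)).smul continuousOn_const
  exact h.const_smul (1 / 4 : ℂ)

theorem continuousOn_connectionTerm {i : ι} {F : M → DiracVec} (hF : ContinuousOn F (S.dom i)) :
    ContinuousOn (connectionTerm S i F) (S.dom i) :=
  continuousOn_finsetSum _ fun c _ => continuousOn_mulVec continuousOn_const
    (continuousOn_mulVec (continuousOn_spinConnection S i c) hF)

theorem continuousOn_formComp {f : ∀ x : M, TangentSpace 𝓘(ℝ, E4) x →L[ℝ] ℝ}
    (hf : IsSmoothOneForm f) (i : ι) (a : Fin 4) :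
    ContinuousOn (formComp S f i a) (S.dom i) :=
  Complex.continuous_ofReal.comp_continuousOn (continuousOn_oneForm hf (continuousOn_frame S i a))

theorem SpinorField.rep_eq_zero (φ : SpinorField S) {i : ι} {x : M} (hx : x ∈ S.dom i)
    (hφ : x ∉ φ.support) : φ.rep i x = 0 := by
  by_contra h
  exact hφ (subset_closure ⟨i, hx, h⟩)

theorem continuousOn_weylPart (φ : SpinorField S) (i : ι) :
    ContinuousOn (weylPart (φ.rep i)) (S.dom i) :=
  continuousOn_pi.2 fun k => continuousOn_pi.1 (φ.smooth_rep i).continuousOn (Sum.inl k)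

theorem star_realStructure_dotProduct_gammaMat_mulVec_twistedDirac
    (f : ∀ x : M, TangentSpace 𝓘(ℝ, E4) x →L[ℝ] ℝ) (i : ι) {a : Fin 4} {α : ℂ}
    (hα : α = 1 ∨ α = -1) {v : DiracVec} (hv : gammaMat a *ᵥ v = α • v) (F : M → DiracVec) (x : M) :
    star (realStructure v) ⬝ᵥ (gammaMat a *ᵥ twistedDirac S f i F x)
      = Complex.I * α * (star (realStructure v) ⬝ᵥ connectionTerm S i F x)
        + Complex.I * α * (star (realStructure v) ⬝ᵥ (∑ c, gammaMat c *ᵥ frameDeriv S i c F x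
          + ∑ c, formComp S f i c x • ((gammaMat c * grading) *ᵥ F x))) := by
  rw [star_realStructure_dotProduct_gammaMat_mulVec hα hv, twistedDirac, diracOp, connectionTerm]
  simp only [Matrix.mulVec_add, Finset.sum_add_distrib, dotProduct_sub, dotProduct_add,
    dotProduct_neg, dotProduct_smul, smul_eq_mul]
  ring

/-! ### Integration of the pointwise identities -/

variable [CompactSpace M] [T2Space M] [MeasurableSpace M] [BorelSpace M]

theorem integrableOn_connection {i : ι} {φ : SpinorField S} (hφ : φ.support ⊆ S.dom i)
    (ψ : SpinorField S) :
    IntegrableOn (fun x => star (realStructure (φ.rep i x)) ⬝ᵥ connectionTerm S i (ψ.rep i) x)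
      (S.dom i) (volumeMeasure g) := by
  refine integrableOn_of_continuousOn_of_support g (S.isOpen_dom i) isClosed_closure hφ
    (continuousOn_dotProduct ?_ (continuousOn_connectionTerm (ψ.smooth_rep i).continuousOn)) ?_
  · exact (continuous_star.comp continuous_realStructure).comp_continuousOn
      (φ.smooth_rep i).continuousOn
  · intro x hx hxφ
    simp [φ.rep_eq_zero hx hxφ, realStructure]

theorem integrableOn_weylPart_dotProduct {i : ι} {φ : SpinorField S} (hφ : φ.support ⊆ S.dom i)
    {h : M → WeylVec} (hh : ContinuousOn h (S.dom i)) :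
    IntegrableOn (fun x => weylPart (φ.rep i) x ⬝ᵥ h x) (S.dom i) (volumeMeasure g) := by
  refine integrableOn_of_continuousOn_of_support g (S.isOpen_dom i) isClosed_closure hφ
    (continuousOn_dotProduct (continuousOn_weylPart φ i) hh) fun x hx hxφ => ?_
  have : weylPart (φ.rep i) x = 0 := by
    ext k
    simp [weylPart, φ.rep_eq_zero hx hxφ]
  rw [this, zero_dotProduct]

/-- Common to all choices of `R`: the pointwise identity `H` passes to the integrals because both
summands are integrable. -/
theorem fermionicForm_eq_add {f : ∀ x : M, TangentSpace 𝓘(ℝ, E4) x →L[ℝ] ℝ} {i : ι} {a : Fin 4}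
    {α : ℂ} (hα : α = 1 ∨ α = -1) {φ : SpinorField S} (hφ : φ ∈ eigenspace S i a α)
    (ψ : SpinorField S) {h : M → WeylVec} (hh : ContinuousOn h (S.dom i))
    (H : ∀ x ∈ S.dom i, Complex.I * α * (star (realStructure (φ.rep i x)) ⬝ᵥ
        (∑ c, gammaMat c *ᵥ frameDeriv S i c (ψ.rep i) x
          + ∑ c, formComp S f i c x • ((gammaMat c * grading) *ᵥ ψ.rep i x)))
      = 2 * (weylPart (φ.rep i) x ⬝ᵥ h x)) :
    fermionicForm S f i a φ ψ = Complex.I * α * connectionForm S i φ ψ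
      + 2 * ∫ x in S.dom i, weylPart (φ.rep i) x ⬝ᵥ h x ∂(volumeMeasure g) := by
  rw [fermionicForm, connectionForm, spinorInner, spinorInner, ← integral_const_mul,
    ← integral_const_mul, ← integral_add ((integrableOn_connection hφ.1 ψ).const_mul _)
      ((integrableOn_weylPart_dotProduct hφ.1 hh).const_mul _)]
  refine setIntegral_congr_fun (S.isOpen_dom i).measurableSet fun x hx => ?_
  simp only [star_realStructure_dotProduct_gammaMat_mulVec_twistedDirac f i hα (hφ.2 x hx), H x hx]

theorem fermionicForm_zero {f : ∀ x : M, TangentSpace 𝓘(ℝ, E4) x →L[ℝ] ℝ}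
    (hf : IsSmoothOneForm f) {i : ι} {α : ℂ} (hα : α = 1 ∨ α = -1) {φ ψ : SpinorField S}
    (hφ : φ ∈ eigenspace S i 0 α) (hψ : ψ ∈ eigenspace S i 0 α) :
    fermionicForm S f i 0 φ ψ = Complex.I * α * connectionForm S i φ ψ
      + 2 * weylFormZero S f i (weylPart (φ.rep i)) (weylPart (ψ.rep i)) := by
  refine fermionicForm_eq_add hα hφ ψ ?_ fun x hx => ?_
  · exact continuousOn_mulVec continuousOn_const
      (((continuousOn_const.mul (continuousOn_formComp hf i 0)).smul
        (continuousOn_weylPart ψ i)).sub (continuousOn_finsetSum _ fun j _ =>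
          continuousOn_mulVec continuousOn_const
            (continuousOn_frameDeriv_weylPart j.succ (ψ.smooth_rep i))))
  · simp only [frameDeriv_weylPart _ (ψ.smooth_rep i) hx]
    exact weyl_identity_zero hα (hφ.2 x hx) (hψ.2 x hx)
      (fun c => gammaMat_mulVec_frameDeriv 0 c (ψ.smooth_rep i) hψ.2 hx)
      fun c => formComp S f i c x

theorem fermionicForm_succ {f : ∀ x : M, TangentSpace 𝓘(ℝ, E4) x →L[ℝ] ℝ}
    (hf : IsSmoothOneForm f) {i : ι} (a : Fin 3) {α : ℂ} (hα : α = 1 ∨ α = -1)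
    {φ ψ : SpinorField S}
    (hφ : φ ∈ eigenspace S i a.succ α) (hψ : ψ ∈ eigenspace S i a.succ α) :
    fermionicForm S f i a.succ φ ψ = Complex.I * α * connectionForm S i φ ψ
      + 2 * weylFormSpace S f i a (weylPart (φ.rep i)) (weylPart (ψ.rep i)) := by
  refine fermionicForm_eq_add hα hφ ψ ?_ fun x hx => ?_
  · have hD (c : Fin 4) := continuousOn_frameDeriv_weylPart c (ψ.smooth_rep i)
    exact continuousOn_mulVec continuousOn_const (((hD 0).add
      ((continuousOn_finsetSum _ fun j _ =>
        continuousOn_mulVec continuousOn_const (hD j.succ)).const_smul Complex.I)).add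
      ((continuousOn_const.mul (continuousOn_formComp hf i a.succ)).smul
        (continuousOn_mulVec continuousOn_const (continuousOn_weylPart ψ i))))
  · simp only [frameDeriv_weylPart _ (ψ.smooth_rep i) hx]
    exact weyl_identity_space a hα (hφ.2 x hx) (hψ.2 x hx)
      (fun c => gammaMat_mulVec_frameDeriv a.succ c (ψ.smooth_rep i) hψ.2 hx)
      fun c => formComp S f i c x

end Geometry

end TwistedSpin

end

open TwistedSpin in
theorem mainTheorem10 {M : Type*} [TopologicalSpace M] [ChartedSpace E4 M]
    [IsManifold 𝓘(ℝ, E4) ∞ M] [CompactSpace M] [T2Space M] [MeasurableSpace M] [BorelSpace M]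
    (g : Metric M) {ι : Type*} (S : SpinStructure g ι)
    (f : ∀ x : M, TangentSpace 𝓘(ℝ, E4) x →L[ℝ] ℝ) (hf : IsSmoothOneForm f)
    (i : ι) (α : ℂ) (hα : α = 1 ∨ α = -1) (N : ℕ) (ψ : Fin N → SpinorField S) :
    ((∀ k, ψ k ∈ eigenspace S i 0 α) →
      fermionicAction S f i 0 ψ
        = (Complex.I * α) • grassmannValue (connectionForm S i) ψ
          + (2 : ℂ) • grassmannValue (weylFormZero S f i) (fun k => weylPart ((ψ k).rep i))) ∧
    (∀ a : Fin 3, (∀ k, ψ k ∈ eigenspace S i a.succ α) →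
      fermionicAction S f i a.succ ψ
        = (Complex.I * α) • grassmannValue (connectionForm S i) ψ
          + (2 : ℂ) • grassmannValue (weylFormSpace S f i a)
              (fun k => weylPart ((ψ k).rep i))) :=
  ⟨fun h => grassmannValue_eq_add fun k l => fermionicForm_zero hf hα (h k) (h l),
    fun a h => grassmannValue_eq_add fun k l => fermionicForm_succ hf a hα (h k) (h l)⟩
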